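/- Let $s\ge 1$ and $\alpha\ge 2$ be integers and let $\gamma_1,\ldots,\gamma_s>0$ be real numbers. For $u\subseteq\{1,\ldots,s\}$ put $\gamma_u=\prod_{j\in u}\gamma_j$, where the empty product equals $1$. Let $\mathcal{H}_{\alpha,\boldsymbol{\gamma}}$ be the weighted Sobolev space of smoothness $\alpha$ on $[0,1)^s$, i.e. the reproducing kernel Hilbert space of functions $[0,1)^s\to\mathbb{R}$ whose reproducing kernel is $$\mathcal{K}_{\alpha,\boldsymbol{\gamma}}(\boldsymbol{x},\boldsymbol{y})=\sum_{u\subseteq\{1,\ldots,s\}}\gamma_u\prod_{j\in u}\left\{\sum_{r=1}^{\alpha}\frac{B_r(x_j)B_r(y_j)}{(r!)^2}+(-1)^{\alpha+1}\frac{B_{2\alpha}(|x_j-y_j|)}{(2\alpha)!}\right\},$$ where $B_r$ is the Bernoulli polynomial of degree $r$. For points $\boldsymbol{x}_0,\ldots,\boldsymbol{x}_{N-1}\in[0,1)^s$ and real weights $w_0,\ldots,w_{N-1}$ the worst-case error of the corresponding cubature rule is $$e^{\mathrm{wor}}(\mathcal{H}_{\alpha,\boldsymbol{\gamma}};P,\boldsymbol{w})=\sup_{\substack{f\in\mathcal{H}_{\alpha,\boldsymbol{\gamma}}\\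 \|f\|\le 1}}\left|\sum_{n=0}^{N-1}w_nf(\boldsymbol{x}_n)-\int_{[0,1)^s}f(\boldsymbol{x})\,d\boldsymbol{x}\right|.$$ Then there is a constant $c_{\alpha,\boldsymbol{\gamma},s}>0$, depending only on $\alpha$, $\gamma_1,\ldots,\gamma_s$ and $s$, such that for every integer $N\ge 1$, all points $\boldsymbol{x}_0,\ldots,\boldsymbol{x}_{N-1}\in[0,1)^s$ (not necessarily distinct) and all $w_0,\ldots,w_{N-1}\in\mathbb{R}$, $$e^{\mathrm{wor}}(\mathcal{H}_{\alpha,\boldsymbol{\gamma}};P,\boldsymbol{w})\ \ge\ c_{\alpha,\boldsymbol{\gamma},s}\,\frac{(\log N)^{(s-1)/2}}{N^{\alpha}}$$ (for $s=1$ the factor $(\log N)^{0}$ is $1$, also when $N=1$). -/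

import Mathlib

open MeasureTheory
open scoped NNReal ENNReal Matrix

/-- The half-open unit cube `[0,1)^s`. -/
abbrev UnitCube (s : ℕ) : Type := Fin s → Set.Ico (0 : ℝ) 1

/-- The one-dimensional kernel
`∑_{r=1}^α B_r(x) B_r(y) / (r!)^2 + (-1)^(α+1) B_{2α}(|x-y|) / (2α)!`. -/
noncomputable def bernoulliKernel (α : ℕ) (x y : ℝ) : ℝ :=
  ∑ r ∈ Finset.Icc 1 α, bernoulliFun r x * bernoulliFun r y / (r.factorial : ℝ) ^ 2
    + (-1) ^ (α + 1) * bernoulliFun (2 * α) |x - y| / ((2 * α).factorial : ℝ)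

/-- The kernel `∑_u γ_u ∏_{j ∈ u} k_α(x_j, y_j)` on the unit cube. -/
noncomputable def weightedKernel {s : ℕ} (α : ℕ) (γ : Finset (Fin s) → ℝ≥0)
    (x y : UnitCube s) : ℝ :=
  ∑ u : Finset (Fin s), (γ u : ℝ) * ∏ j ∈ u, bernoulliKernel α (x j) (y j)

theorem posSemidef_rankOne {X : Type*} (f : X → ℝ) :
    (Matrix.of fun x y => f x * f y : Matrix X X ℝ).PosSemidef := by
  refine ⟨by ext x y; simp [mul_comm], fun c => ?_⟩
  have : (c.sum fun i xi => c.sum fun j xj =>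
      star xi * (Matrix.of fun x y => f x * f y : Matrix X X ℝ) i j * xj)
      = (∑ i ∈ c.support, c i * f i) ^ 2 := by
    simp only [Finsupp.sum, sq, Finset.sum_mul_sum]
    refine Finset.sum_congr rfl fun i _ => Finset.sum_congr rfl fun j _ => ?_
    simp; ring
  rw [this]; positivity

theorem posSemidef_of_hasSum {X : Type*} {A : ℕ → Matrix X X ℝ} {B : Matrix X X ℝ}
    (hA : ∀ n, (A n).PosSemidef) (h : ∀ x y, HasSum (fun n => A n x y) (B x y)) :
    B.PosSemidef := by
  refine ⟨?_, fun c => ?_⟩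
  · ext x y
    have h1 := h y x
    have : (fun n => A n y x) = fun n => A n x y := by
      funext n; simpa using (hA n).isHermitian.apply x y
    rw [this] at h1
    simpa using h1.unique (h x y)
  · have : HasSum (fun n => c.sum fun i xi => c.sum fun j xj => star xi * A n i j * xj)
        (c.sum fun i xi => c.sum fun j xj => star xi * B i j * xj) :=
      hasSum_sum fun i _ => hasSum_sum fun j _ => ((h i j).mul_left _).mul_right _
    exact this.nonneg fun n => (hA n).2 c

theorem posSemidef_bernoulliKernel {α : ℕ} (hα : α ≠ 0) :
    (Matrix.of fun x y : Set.Ico (0 : ℝ) 1 => bernoulliKernel α x y).PosSemidef := by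
  have h1 : (Matrix.of fun x y : Set.Ico (0 : ℝ) 1 =>
      ∑ r ∈ Finset.Icc 1 α,
        bernoulliFun r x * bernoulliFun r y / (r.factorial : ℝ) ^ 2).PosSemidef := by
    have := Matrix.posSemidef_sum (Finset.Icc 1 α) fun r _ =>
      posSemidef_rankOne fun x : Set.Ico (0 : ℝ) 1 => bernoulliFun r x / (r.factorial : ℝ)
    convert this using 1
    ext x y
    simp only [Matrix.of_apply, Matrix.sum_apply]
    refine Finset.sum_congr rfl fun r _ => ?_
    ring
  have h2 : (Matrix.of fun x y : Set.Ico (0 : ℝ) 1 =>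
      (-1) ^ (α + 1) * bernoulliFun (2 * α) |(x : ℝ) - y|
        / ((2 * α).factorial : ℝ)).PosSemidef := by
    refine posSemidef_of_hasSum (A := fun n => (2 / (2 * Real.pi) ^ (2 * α)
      * (1 / (n : ℝ) ^ (2 * α))) • ((Matrix.of fun x y : Set.Ico (0 : ℝ) 1 =>
          Real.cos (2 * Real.pi * n * x) * Real.cos (2 * Real.pi * n * y))
        + Matrix.of fun x y : Set.Ico (0 : ℝ) 1 =>
          Real.sin (2 * Real.pi * n * x) * Real.sin (2 * Real.pi * n * y))) ?_ ?_
    · intro n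
      exact ((posSemidef_rankOne fun x : Set.Ico (0 : ℝ) 1 =>
          Real.cos (2 * Real.pi * n * x)).add (posSemidef_rankOne fun x : Set.Ico (0 : ℝ) 1 =>
          Real.sin (2 * Real.pi * n * x))).smul (by positivity)
    · rintro ⟨x, hx0, hx1⟩ ⟨y, hy0, hy1⟩
      have hmem : |x - y| ∈ Set.Icc (0 : ℝ) 1 :=
        ⟨abs_nonneg _, by rw [abs_le]; constructor <;> linarith⟩
      have key := (hasSum_one_div_nat_pow_mul_cos hα hmem).mul_left
        (2 / (2 * Real.pi) ^ (2 * α))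
      convert! key using 1
      · funext n
        have : Real.cos (2 * Real.pi * n * |x - y|)
            = Real.cos (2 * Real.pi * n * x - 2 * Real.pi * n * y) := by
          rw [← mul_sub, ← Real.cos_abs (2 * Real.pi * n * (x - y)), abs_mul,
            abs_of_nonneg (by positivity : (0 : ℝ) ≤ 2 * Real.pi * n)]
        rw [this, Real.cos_sub]
        simp [mul_assoc]
      · have hp : (2 * Real.pi) ^ (2 * α) ≠ 0 := by positivity
        simp only [Matrix.of_apply, bernoulliFun]
        field_simp
  have h3 := h1.add h2
  exact h3

theorem posSemidef_weightedKernel_real {s α : ℕ} (hα : α ≠ 0) (γ : Finset (Fin s) → ℝ≥0) :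
    (Matrix.of fun x y : UnitCube s => weightedKernel α γ x y).PosSemidef := by
  have hprod : ∀ u : Finset (Fin s), (Matrix.of fun x y : UnitCube s =>
      ∏ j ∈ u, bernoulliKernel α (x j) (y j)).PosSemidef := by
    intro u
    induction u using Finset.induction_on with
    | empty => simpa using posSemidef_rankOne fun _ : UnitCube s => (1 : ℝ)
    | insert a t ha ih =>
      have := ((posSemidef_bernoulliKernel hα).submatrix fun x : UnitCube s => x a).hadamard ih
      have he : (Matrix.of fun x y : UnitCube s =>
          ∏ j ∈ insert a t, bernoulliKernel α (x j) (y j))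
          = ((Matrix.of fun x y : Set.Ico (0 : ℝ) 1 => bernoulliKernel α x y).submatrix
            (fun x : UnitCube s => x a) (fun x => x a)) ⊙
            (Matrix.of fun x y : UnitCube s => ∏ j ∈ t, bernoulliKernel α (x j) (y j)) := by
        ext x y
        simp [Finset.prod_insert ha]
      rw [he]
      exact this
  have := Matrix.posSemidef_sum Finset.univ fun u _ =>
    (hprod u).smul (a := (γ u : ℝ)) (γ u).coe_nonneg
  convert this using 1
  ext x y
  simp [weightedKernel, Matrix.sum_apply]

/-- The kernel `weightedKernel α γ` as an operator-valued matrix (`t ↦ K(x, y) t` on `ℝ`). -/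
noncomputable def weightedKernelMatrix {s : ℕ} (α : ℕ) (γ : Finset (Fin s) → ℝ≥0) :
    Matrix (UnitCube s) (UnitCube s) (ℝ →L[ℝ] ℝ) :=
  Matrix.of fun x y => weightedKernel α γ x y • ContinuousLinearMap.id ℝ ℝ

instance posSemidef_weightedKernelMatrix {s α : ℕ} [NeZero α] (γ : Finset (Fin s) → ℝ≥0) :
    Fact (weightedKernelMatrix α γ).PosSemidef := by
  have h := posSemidef_weightedKernel_real (NeZero.ne α) γ
  refine ⟨((RKHS.posSemidef_tfae (K := weightedKernelMatrix α γ)).out 0 2 rfl rfl).mpr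
    ⟨?_, fun v => ?_⟩⟩
  · ext x y
    have := h.isHermitian.apply x y
    simp at this
    have hid : ContinuousLinearMap.adjoint (ContinuousLinearMap.id ℝ ℝ)
        = ContinuousLinearMap.id ℝ ℝ := ContinuousLinearMap.adjoint_id
    simp [weightedKernelMatrix, this, ContinuousLinearMap.star_eq_adjoint, hid]
  · have := h.2 v
    refine this.trans_eq ?_
    simp only [Finsupp.sum, weightedKernelMatrix, RCLike.re_to_real]
    refine Finset.sum_congr rfl fun i _ => Finset.sum_congr rfl fun j _ => ?_
    have : weightedKernel α γ j i = weightedKernel α γ i j := by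
      simpa using h.isHermitian.apply i j
    simp [this]
    ring

/-- The weighted Sobolev space of smoothness `α` on `[0,1)^s`: the reproducing kernel Hilbert space
of functions `[0,1)^s → ℝ` with reproducing kernel `weightedKernel α γ`. -/
abbrev WeightedSobolevSpace {s : ℕ} (α : ℕ) [NeZero α] (γ : Finset (Fin s) → ℝ≥0) : Type :=
  RKHS.OfKernel (weightedKernelMatrix α γ)

/-- Lebesgue measure on the unit cube. -/
noncomputable def cubeMeasure (s : ℕ) : Measure (UnitCube s) :=
  Measure.pi fun _ => (volume : Measure ℝ).comap Subtype.val

/-- Worst-case error, over the unit ball of a reproducing kernel Hilbert space `H` of functions on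
`[0,1)^s`, of the cubature rule with points `x n` and weights `w n`. -/
noncomputable def worstCaseError {s N : ℕ} (H : Type*) [NormedAddCommGroup H]
    [InnerProductSpace ℝ H] [RKHS ℝ H (UnitCube s) ℝ] (x : Fin N → UnitCube s) (w : Fin N → ℝ) :
    ℝ≥0∞ :=
  ⨆ (f : H) (_ : ‖f‖ ≤ 1), ENNReal.ofReal |∑ n, w n * f (x n) - ∫ t, f t ∂(cubeMeasure s)|

theorem isProbabilityMeasure_comap_Ico : IsProbabilityMeasure ((volume : Measure ℝ).comap
    (Subtype.val : Set.Ico (0 : ℝ) 1 → ℝ)) := by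
  refine ⟨?_⟩
  rw [comap_subtype_coe_apply measurableSet_Ico, Set.image_univ, Subtype.range_coe,
    Real.volume_Ico]
  simp

theorem continuous_bernoulliKernel (α : ℕ) :
    Continuous fun p : ℝ × ℝ => bernoulliKernel α p.1 p.2 := by
  have h : ∀ r, Continuous (bernoulliFun r) := fun r => continuous_bernoulliFun r
  unfold bernoulliKernel
  have h1 : ∀ r, Continuous fun p : ℝ × ℝ => bernoulliFun r p.1 := fun r => (h r).comp continuous_fst
  have h2 : ∀ r, Continuous fun p : ℝ × ℝ => bernoulliFun r p.2 := fun r => (h r).comp continuous_snd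
  have h3 : Continuous fun p : ℝ × ℝ => bernoulliFun (2 * α) |p.1 - p.2| :=
    (h _).comp (continuous_fst.sub continuous_snd).abs
  fun_prop

theorem integral_bernoulliFun_abs_sub {k : ℕ} (hk : k ≠ 0) {x : ℝ} (hx : x ∈ Set.Icc (0 : ℝ) 1) :
    ∫ y in (0 : ℝ)..1, bernoulliFun (2 * k) |x - y| = 0 := by
  have hc : Continuous fun y => bernoulliFun (2 * k) |x - y| :=
    (continuous_bernoulliFun (2 * k)).comp (continuous_const.sub continuous_id).abs
  rw [← intervalIntegral.integral_add_adjacent_intervals (b := x)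
    (hc.intervalIntegrable _ _) (hc.intervalIntegrable _ _)]
  have h1 : ∫ y in (0 : ℝ)..x, bernoulliFun (2 * k) |x - y|
      = ∫ y in (0 : ℝ)..x, bernoulliFun (2 * k) y := by
    rw [intervalIntegral.integral_congr (g := fun y => bernoulliFun (2 * k) (x - y))]
    · simp
    · intro y hy
      rw [Set.uIcc_of_le hx.1] at hy
      simp [abs_of_nonneg (sub_nonneg.2 hy.2)]
  have h2 : ∫ y in x..(1 : ℝ), bernoulliFun (2 * k) |x - y|
      = ∫ y in x..(1 : ℝ), bernoulliFun (2 * k) y := by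
    rw [intervalIntegral.integral_congr (g := fun y => bernoulliFun (2 * k) (1 + x - y))]
    · simp
    · intro y hy
      rw [Set.uIcc_of_le hx.2] at hy
      have : (1 + x - y) = 1 - (y - x) := by ring
      simp only [this, bernoulliFun_eval_one_sub]
      rw [abs_sub_comm, abs_of_nonneg (sub_nonneg.2 hy.1)]
      simp
  rw [h1, h2, intervalIntegral.integral_add_adjacent_intervals
    (intervalIntegrable_bernoulliFun _ _ _) (intervalIntegrable_bernoulliFun _ _ _),
    integral_bernoulliFun_eq_zero (by omega)]

theorem integral_bernoulliKernel {α : ℕ} (hα : α ≠ 0) {x : ℝ} (hx : x ∈ Set.Icc (0 : ℝ) 1) :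
    ∫ y in (0 : ℝ)..1, bernoulliKernel α x y = 0 := by
  have h : ∀ r, Continuous (bernoulliFun r) := fun r => continuous_bernoulliFun r
  have hc : Continuous fun y => bernoulliFun (2 * α) |x - y| :=
    (h _).comp (continuous_const.sub continuous_id).abs
  unfold bernoulliKernel
  rw [intervalIntegral.integral_add, intervalIntegral.integral_finsetSum]
  · rw [Finset.sum_eq_zero, intervalIntegral.integral_div, intervalIntegral.integral_const_mul,
      integral_bernoulliFun_abs_sub hα hx]
    · simp
    · intro r hr
      have : r ≠ 0 := by have := Finset.mem_Icc.1 hr; omega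
      simp [intervalIntegral.integral_div, intervalIntegral.integral_const_mul,
        integral_bernoulliFun_eq_zero this]
  · intro r _
    exact Continuous.intervalIntegrable (by fun_prop) _ _
  · exact Continuous.intervalIntegrable (by fun_prop) _ _
  · exact Continuous.intervalIntegrable (by fun_prop) _ _

theorem weightedKernel_prod {s : ℕ} (α : ℕ) (γ : Fin s → ℝ≥0) (x y : UnitCube s) :
    weightedKernel α (fun u => ∏ j ∈ u, γ j) x y
      = ∏ j, (1 + γ j * bernoulliKernel α (x j) (y j)) := by
  simp [weightedKernel, Finset.prod_one_add, Finset.prod_mul_distrib]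

theorem continuous_weightedKernel_prod {s : ℕ} (α : ℕ) (γ : Fin s → ℝ≥0) :
    Continuous fun p : UnitCube s × UnitCube s =>
      weightedKernel α (fun u => ∏ j ∈ u, γ j) p.1 p.2 := by
  simp only [weightedKernel_prod]
  refine continuous_finsetProd _ fun j _ => ?_
  have : Continuous fun p : UnitCube s × UnitCube s => ((p.1 j : ℝ), (p.2 j : ℝ)) := by fun_prop
  have := (continuous_bernoulliKernel α).comp this
  exact continuous_const.add (continuous_const.mul this)

theorem exists_weightedKernel_prod_diag_le {s : ℕ} (α : ℕ) (γ : Fin s → ℝ≥0) :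
    ∃ C, ∀ x : UnitCube s, weightedKernel α (fun u => ∏ j ∈ u, γ j) x x ≤ C := by
  have hc : Continuous fun t : ℝ => bernoulliKernel α t t :=
    (continuous_bernoulliKernel α).comp (continuous_id.prodMk continuous_id)
  obtain ⟨C, hC⟩ := (isCompact_Icc (a := (0 : ℝ)) (b := 1)).exists_bound_of_continuousOn
    hc.continuousOn
  refine ⟨∏ j, (1 + γ j * C), fun x => ?_⟩
  rw [weightedKernel_prod]
  refine (le_abs_self _).trans ?_
  rw [Finset.abs_prod]
  refine Finset.prod_le_prod (fun _ _ => abs_nonneg _) fun j _ => ?_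
  have := hC (x j) ⟨(x j).2.1, (x j).2.2.le⟩
  refine (abs_add_le _ _).trans ?_
  rw [abs_one, abs_mul, NNReal.abs_eq]
  gcongr
  simpa using this

theorem integral_weightedKernel_prod {s α : ℕ} (hα : α ≠ 0) (γ : Fin s → ℝ≥0) (x : UnitCube s) :
    ∫ y, weightedKernel α (fun u => ∏ j ∈ u, γ j) x y ∂cubeMeasure s = 1 := by
  have := isProbabilityMeasure_comap_Ico
  simp only [weightedKernel_prod, cubeMeasure]
  rw [integral_fintype_prod_eq_prod (𝕜 := ℝ)
    (f := fun j (y : Set.Ico (0 : ℝ) 1) => 1 + γ j * bernoulliKernel α (x j) y)]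
  refine Finset.prod_eq_one fun j _ => ?_
  rw [integral_subtype_comap measurableSet_Ico
    (fun y : ℝ => 1 + γ j * bernoulliKernel α (x j) y), integral_Ico_eq_integral_Ioc,
    ← intervalIntegral.integral_of_le zero_le_one]
  have hc : Continuous fun y : ℝ => bernoulliKernel α (x j) y :=
    (continuous_bernoulliKernel α).comp (continuous_const.prodMk continuous_id)
  have hi : IntervalIntegrable (fun y => (γ j : ℝ) * bernoulliKernel α (x j) y) volume 0 1 :=
    (continuous_const.mul hc).intervalIntegrable _ _
  rw [intervalIntegral.integral_add (by simp) hi, intervalIntegral.integral_const_mul,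
    integral_bernoulliKernel hα ⟨(x j).2.1, (x j).2.2.le⟩]
  simp

section Representer

variable {s α : ℕ} [NeZero α] (γ : Fin s → ℝ≥0)

/-- The function `K(·, x)` as an element of the weighted Sobolev space. -/
noncomputable def kernelSection (x : UnitCube s) :
    WeightedSobolevSpace α fun u => ∏ j ∈ u, γ j :=
  RKHS.kerFun (WeightedSobolevSpace α fun u => ∏ j ∈ u, γ j) x (1 : ℝ)

theorem inner_kernelSection_left (x : UnitCube s)
    (f : WeightedSobolevSpace α fun u => ∏ j ∈ u, γ j) :
    inner ℝ (kernelSection γ x) f = f x := by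
  simp [kernelSection]

theorem inner_kernelSection (x y : UnitCube s) :
    inner ℝ (kernelSection (α := α) γ x) (kernelSection γ y)
      = weightedKernel α (fun u => ∏ j ∈ u, γ j) x y := by
  rw [inner_kernelSection_left, kernelSection, RKHS.kerFun_apply, RKHS.OfKernel.kernel_ofKernel]
  simp [weightedKernelMatrix]

theorem continuous_kernelSection : Continuous (kernelSection (α := α) γ) := by
  refine continuous_iff_continuousAt.2 fun x => tendsto_iff_norm_sub_tendsto_zero.2 ?_
  have hK := continuous_weightedKernel_prod α γ
  have h : ∀ y, ‖kernelSection (α := α) γ y - kernelSection γ x‖ = √(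
      weightedKernel α (fun u => ∏ j ∈ u, γ j) y y - 2 * weightedKernel α (fun u => ∏ j ∈ u, γ j) y x
      + weightedKernel α (fun u => ∏ j ∈ u, γ j) x x) := by
    intro y
    rw [← Real.sqrt_sq (norm_nonneg _), norm_sub_sq_real, ← real_inner_self_eq_norm_sq,
      ← real_inner_self_eq_norm_sq, inner_kernelSection, inner_kernelSection, inner_kernelSection]
  simp only [h]
  have hc : Continuous fun y => √(
      weightedKernel α (fun u => ∏ j ∈ u, γ j) y y - 2 * weightedKernel α (fun u => ∏ j ∈ u, γ j) y x
      + weightedKernel α (fun u => ∏ j ∈ u, γ j) x x) := by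
    have h1 := hK.comp (continuous_id.prodMk continuous_id)
    have h2 := hK.comp (continuous_id.prodMk (continuous_const (y := x)))
    exact ((h1.sub (continuous_const.mul h2)).add continuous_const).sqrt
  convert hc.tendsto x using 2
  rw [← Real.sqrt_zero]
  congr 1
  ring

theorem integrable_kernelSection :
    Integrable (kernelSection (α := α) γ) (cubeMeasure s) := by
  have := isProbabilityMeasure_comap_Ico
  have : IsProbabilityMeasure (cubeMeasure s) := by unfold cubeMeasure; infer_instance
  obtain ⟨C, hC⟩ := exists_weightedKernel_prod_diag_le α γ
  refine Integrable.of_bound (continuous_kernelSection γ).aestronglyMeasurable (√C)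
    (Filter.Eventually.of_forall fun x => ?_)
  refine Real.le_sqrt_of_sq_le ?_
  rw [← real_inner_self_eq_norm_sq, inner_kernelSection]
  exact hC x

/-- The Riesz representer of integration over the unit cube. -/
noncomputable def integralRepresenter (α : ℕ) [NeZero α] :
    WeightedSobolevSpace α fun u => ∏ j ∈ u, γ j :=
  ∫ t, kernelSection γ t ∂cubeMeasure s

theorem inner_integralRepresenter (f : WeightedSobolevSpace α fun u => ∏ j ∈ u, γ j) :
    inner ℝ (integralRepresenter γ α) f = ∫ t, f t ∂cubeMeasure s := by
  rw [real_inner_comm, integralRepresenter, ← integral_inner (integrable_kernelSection γ)]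
  refine integral_congr_ae (Filter.Eventually.of_forall fun y => ?_)
  change inner ℝ f (kernelSection γ y) = _
  rw [real_inner_comm, inner_kernelSection_left]

theorem integralRepresenter_apply (x : UnitCube s) : integralRepresenter γ α x = 1 := by
  rw [← inner_kernelSection_left, real_inner_comm, inner_integralRepresenter]
  refine Eq.trans ?_ (integral_weightedKernel_prod (NeZero.ne α) γ x)
  refine integral_congr_ae (Filter.Eventually.of_forall fun y => ?_)
  rw [← inner_kernelSection_left, real_inner_comm, inner_kernelSection]

theorem sqrt_le_worstCaseError {N : ℕ} (x : Fin N → UnitCube s) (w : Fin N → ℝ) :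
    ENNReal.ofReal √(∑ n, ∑ m, w n * w m * weightedKernel α (fun u => ∏ j ∈ u, γ j) (x n) (x m)
        - 2 * ∑ n, w n + 1)
      ≤ worstCaseError (WeightedSobolevSpace α fun u => ∏ j ∈ u, γ j) x w := by
  have : IsProbabilityMeasure (cubeMeasure s) := by
    have := isProbabilityMeasure_comap_Ico
    unfold cubeMeasure; infer_instance
  set v : WeightedSobolevSpace α fun u => ∏ j ∈ u, γ j :=
    ∑ n, w n • kernelSection γ (x n) - integralRepresenter γ α with hv
  have hin : ∀ f, inner ℝ v f = ∑ n, w n * f (x n) - ∫ t, f t ∂cubeMeasure s := by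
    intro f
    rw [hv, inner_sub_left, sum_inner, inner_integralRepresenter]
    congr 1
    refine Finset.sum_congr rfl fun n _ => ?_
    rw [inner_smul_left, inner_kernelSection_left]
    simp
  have hnorm : ∑ n, ∑ m, w n * w m * weightedKernel α (fun u => ∏ j ∈ u, γ j) (x n) (x m)
        - 2 * ∑ n, w n + 1 = ‖v‖ ^ 2 := by
    have h1 : inner ℝ (integralRepresenter γ α) (integralRepresenter γ α) = (1 : ℝ) := by
      rw [inner_integralRepresenter]; simp [integralRepresenter_apply]
    rw [hv, norm_sub_sq_real, ← real_inner_self_eq_norm_sq, ← real_inner_self_eq_norm_sq, h1]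
    congr 2
    · simp only [sum_inner, inner_sum, inner_smul_left, inner_smul_right, inner_kernelSection]
      rw [Finset.sum_comm]
      simp [mul_assoc, mul_left_comm, Finset.mul_sum]
    · simp [sum_inner, inner_smul_left, inner_kernelSection_left, integralRepresenter_apply]
  rw [hnorm, Real.sqrt_sq (norm_nonneg _)]
  refine le_trans ?_ (le_iSup₂ (‖v‖⁻¹ • v) ?_)
  · rw [← hin, inner_smul_right, real_inner_self_eq_norm_sq]
    refine ENNReal.ofReal_le_ofReal (le_of_eq ?_)
    rcases eq_or_ne ‖v‖ 0 with h | h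
    · simp [h]
    · rw [sq, inv_mul_cancel_left₀ h, abs_of_nonneg (norm_nonneg _)]
  · rw [norm_smul, norm_inv, norm_norm]
    exact inv_mul_le_one
end Representer

/-- The trigonometric polynomial `1 + ∑_{n=1}^M 2 β n^{-2α} cos(2πnt)`. -/
noncomputable def truncKernel (α : ℕ) (β : ℝ) (M : ℕ) (t : ℝ) : ℝ :=
  1 + ∑ n ∈ Finset.Icc 1 M, 2 * β / (n : ℝ) ^ (2 * α) * Real.cos (2 * Real.pi * n * t)

/-- The Fourier coefficients of `truncKernel`. -/
noncomputable def truncCoeff (α : ℕ) (β : ℝ) (h : ℤ) : ℝ :=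
  if h = 0 then 1 else β / (h : ℝ) ^ (2 * α)

theorem posSemidef_cos_sub (c : ℝ) :
    (Matrix.of fun x y : Set.Ico (0 : ℝ) 1 => Real.cos (c * (x - y))).PosSemidef := by
  convert (posSemidef_rankOne fun x : Set.Ico (0 : ℝ) 1 => Real.cos (c * x)).add
    (posSemidef_rankOne fun x : Set.Ico (0 : ℝ) 1 => Real.sin (c * x)) using 1
  ext x y
  simp [mul_sub, Real.cos_sub]

theorem posSemidef_truncKernel (α : ℕ) {β : ℝ} (hβ : 0 ≤ β) (M : ℕ) :
    (Matrix.of fun x y : Set.Ico (0 : ℝ) 1 => truncKernel α β M (x - y)).PosSemidef := by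
  have h1 := posSemidef_rankOne fun _ : Set.Ico (0 : ℝ) 1 => (1 : ℝ)
  have h2 := Matrix.posSemidef_sum (Finset.Icc 1 M) fun n _ =>
    (posSemidef_cos_sub (2 * Real.pi * n)).smul
      (a := 2 * β / (n : ℝ) ^ (2 * α)) (by positivity)
  convert h1.add h2 using 1
  ext x y
  simp [truncKernel, Matrix.sum_apply]

theorem posSemidef_sub_truncKernel {α : ℕ} (hα : α ≠ 0) {β γ : ℝ}
    (hβγ : β * (2 * Real.pi) ^ (2 * α) ≤ γ) (hγ : 0 ≤ γ) (M : ℕ) :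
    (Matrix.of fun x y : Set.Ico (0 : ℝ) 1 =>
      1 + γ * bernoulliKernel α x y - truncKernel α β M (x - y)).PosSemidef := by
  have h1 : (Matrix.of fun x y : Set.Ico (0 : ℝ) 1 =>
      ∑ r ∈ Finset.Icc 1 α,
        bernoulliFun r x * bernoulliFun r y / (r.factorial : ℝ) ^ 2).PosSemidef := by
    convert Matrix.posSemidef_sum (Finset.Icc 1 α) fun r _ =>
      posSemidef_rankOne fun x : Set.Ico (0 : ℝ) 1 => bernoulliFun r x / (r.factorial : ℝ) using 1
    ext x y
    simp only [Matrix.of_apply, Matrix.sum_apply]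
    exact Finset.sum_congr rfl fun r _ => by ring
  have h2 : (Matrix.of fun x y : Set.Ico (0 : ℝ) 1 =>
      γ * ((-1) ^ (α + 1) * bernoulliFun (2 * α) |(x : ℝ) - y| / ((2 * α).factorial : ℝ))
        - ∑ n ∈ Finset.Icc 1 M, 2 * β / (n : ℝ) ^ (2 * α)
          * Real.cos (2 * Real.pi * n * (x - y))).PosSemidef := by
    refine posSemidef_of_hasSum (A := fun n => (2 * γ / (2 * Real.pi) ^ (2 * α)
      * (1 / (n : ℝ) ^ (2 * α)) - if n ∈ Finset.Icc 1 M then 2 * β / (n : ℝ) ^ (2 * α) else 0) •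
        Matrix.of fun x y : Set.Ico (0 : ℝ) 1 => Real.cos (2 * Real.pi * n * (x - y))) ?_ ?_
    · intro n
      refine (posSemidef_cos_sub _).smul ?_
      have hle : 2 * β / (n : ℝ) ^ (2 * α)
          ≤ 2 * γ / (2 * Real.pi) ^ (2 * α) * (1 / (n : ℝ) ^ (2 * α)) := by
        have : β ≤ γ / (2 * Real.pi) ^ (2 * α) := (le_div_iff₀ (by positivity)).2 hβγ
        rw [mul_one_div, mul_div_assoc 2 γ]
        gcongr
      split_ifs
      · linarith
      · rw [sub_zero]; positivity
    · rintro ⟨x, hx0, hx1⟩ ⟨y, hy0, hy1⟩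
      have hmem : |x - y| ∈ Set.Icc (0 : ℝ) 1 :=
        ⟨abs_nonneg _, by rw [abs_le]; constructor <;> linarith⟩
      have hs := (hasSum_one_div_nat_pow_mul_cos hα hmem).mul_left
        (2 * γ / (2 * Real.pi) ^ (2 * α))
      have ht : HasSum (fun n : ℕ => (if n ∈ Finset.Icc 1 M then 2 * β / (n : ℝ) ^ (2 * α) else 0)
          * Real.cos (2 * Real.pi * n * (x - y))) (∑ n ∈ Finset.Icc 1 M,
            (if n ∈ Finset.Icc 1 M then 2 * β / (n : ℝ) ^ (2 * α) else 0)
          * Real.cos (2 * Real.pi * n * (x - y))) :=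
        hasSum_sum_of_ne_finset_zero fun n hn => by rw [if_neg hn, zero_mul]
      convert! hs.sub ht using 1
      · funext n
        have : Real.cos (2 * Real.pi * n * |x - y|) = Real.cos (2 * Real.pi * n * (x - y)) := by
          rw [← Real.cos_abs (2 * Real.pi * n * (x - y)), abs_mul,
            abs_of_nonneg (by positivity : (0 : ℝ) ≤ 2 * Real.pi * n)]
        rw [this]
        simp only [Matrix.smul_apply, Matrix.of_apply, smul_eq_mul]
        ring
      · have hp : (2 * Real.pi) ^ (2 * α) ≠ 0 := by positivity
        simp only [Matrix.of_apply, bernoulliFun]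
        congr 1
        · field_simp
        · exact Finset.sum_congr rfl fun n hn => by rw [if_pos hn]
  convert (h1.smul hγ).add h2 using 1
  ext x y
  simp only [bernoulliKernel, truncKernel, Matrix.add_apply, Matrix.smul_apply, Matrix.of_apply,
    smul_eq_mul]
  ring

theorem posSemidef_prod {X ι : Type*} (u : Finset ι) (A : ι → Matrix X X ℝ)
    (hA : ∀ j ∈ u, (A j).PosSemidef) : (Matrix.of fun x y => ∏ j ∈ u, A j x y).PosSemidef := by
  classical
  induction u using Finset.induction_on with
  | empty => simpa using posSemidef_rankOne fun _ : X => (1 : ℝ)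
  | insert a t ha ih =>
    have h := (hA a (by simp)).hadamard (ih fun j hj => hA j (by simp [hj]))
    have he : (Matrix.of fun x y => ∏ j ∈ insert a t, A j x y)
        = A a ⊙ Matrix.of fun x y => ∏ j ∈ t, A j x y := by
      ext x y
      simp [Finset.prod_insert ha]
    rw [he]
    exact h

theorem posSemidef_prod_sub_prod {X ι : Type*} (u : Finset ι) (A B : ι → Matrix X X ℝ)
    (hB : ∀ j ∈ u, (B j).PosSemidef) (hAB : ∀ j ∈ u, (A j - B j).PosSemidef) :
    (Matrix.of fun x y => ∏ j ∈ u, A j x y - ∏ j ∈ u, B j x y).PosSemidef := by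
  classical
  induction u using Finset.induction_on with
  | empty => simpa using posSemidef_rankOne fun _ : X => (0 : ℝ)
  | insert a t ha ih =>
    have hA : ∀ j ∈ insert a t, (A j).PosSemidef := fun j hj => by
      simpa using (hAB j hj).add (hB j hj)
    have h1 := (hAB a (by simp)).hadamard
      (posSemidef_prod t A fun j hj => hA j (by simp [hj]))
    have h2 := (hB a (by simp)).hadamard
      (ih (fun j hj => hB j (by simp [hj])) fun j hj => hAB j (by simp [hj]))
    have he : (Matrix.of fun x y => ∏ j ∈ insert a t, A j x y - ∏ j ∈ insert a t, B j x y)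
        = (A a - B a) ⊙ (Matrix.of fun x y => ∏ j ∈ t, A j x y)
          + B a ⊙ Matrix.of fun x y => ∏ j ∈ t, A j x y - ∏ j ∈ t, B j x y := by
      ext x y
      simp [Finset.prod_insert ha]
      ring
    rw [he]
    exact h1.add h2

theorem Matrix.PosSemidef.sum_sum_nonneg {X ι : Type*} [Fintype ι] {A : Matrix X X ℝ}
    (hA : A.PosSemidef) (x : ι → X) (w : ι → ℝ) : 0 ≤ ∑ n, ∑ m, w n * w m * A (x n) (x m) := by
  classical
  have := (hA.submatrix x).dotProduct_mulVec_nonneg w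
  refine this.trans_eq ?_
  simp only [dotProduct, Matrix.mulVec, Finset.mul_sum]
  exact Finset.sum_congr rfl fun n _ => Finset.sum_congr rfl fun m _ => by simp; ring

theorem sum_truncKernel_le_sum_weightedKernel {s α : ℕ} (hα : α ≠ 0) (γ : Fin s → ℝ≥0) {β : ℝ}
    (hβ : 0 ≤ β) (hβγ : ∀ j, β * (2 * Real.pi) ^ (2 * α) ≤ γ j) (M : ℕ) {N : ℕ}
    (x : Fin N → UnitCube s) (w : Fin N → ℝ) :
    ∑ n, ∑ m, w n * w m * ∏ j, truncKernel α β M (x n j - x m j)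
      ≤ ∑ n, ∑ m, w n * w m * weightedKernel α (fun u => ∏ j ∈ u, γ j) (x n) (x m) := by
  have h := posSemidef_prod_sub_prod (X := UnitCube s) Finset.univ
    (fun j => (Matrix.of fun x y : Set.Ico (0 : ℝ) 1 =>
      1 + γ j * bernoulliKernel α x y).submatrix (fun x : UnitCube s => x j) fun x => x j)
    (fun j => (Matrix.of fun x y : Set.Ico (0 : ℝ) 1 =>
      truncKernel α β M (x - y)).submatrix (fun x : UnitCube s => x j) fun x => x j)
    (fun j _ => (posSemidef_truncKernel α hβ M).submatrix _)
    (fun j _ => (posSemidef_sub_truncKernel hα (hβγ j) (γ j).2 M).submatrix _)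
  have := h.sum_sum_nonneg x w
  simp only [Matrix.of_apply, Matrix.submatrix_apply, mul_sub, Finset.sum_sub_distrib,
    ← weightedKernel_prod] at this
  linarith

theorem truncKernel_eq_sum_exp (α : ℕ) (β : ℝ) (M : ℕ) (t : ℝ) :
    (truncKernel α β M t : ℂ) = ∑ h ∈ Finset.Icc (-M : ℤ) M,
      (truncCoeff α β h : ℂ) * Complex.exp (2 * Real.pi * Complex.I * h * t) := by
  have hodd : ∑ h ∈ Finset.Icc (-M : ℤ) M, truncCoeff α β h * Real.sin (2 * Real.pi * h * t) = 0 := by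
    have : ∑ h ∈ Finset.Icc (-M : ℤ) M, truncCoeff α β h * Real.sin (2 * Real.pi * h * t)
        = ∑ h ∈ Finset.Icc (-M : ℤ) M, -(truncCoeff α β h * Real.sin (2 * Real.pi * h * t)) := by
      refine Finset.sum_nbij' (fun h => -h) (fun h => -h) ?_ ?_ ?_ ?_ ?_
      · intro h hh; simp only [Finset.mem_Icc] at hh ⊢; omega
      · intro h hh; simp only [Finset.mem_Icc] at hh ⊢; omega
      · simp
      · simp
      · intro h _
        simp [truncCoeff, pow_mul]
    rw [Finset.sum_neg_distrib] at this
    linarith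
  have heven : ∑ h ∈ Finset.Icc (-M : ℤ) M, truncCoeff α β h * Real.cos (2 * Real.pi * h * t)
      = truncKernel α β M t := by
    clear hodd
    unfold truncKernel
    induction M with
    | zero => simp [truncCoeff]
    | succ M ih =>
      have hI : Finset.Icc (-((M + 1 : ℕ) : ℤ)) ((M + 1 : ℕ) : ℤ)
          = insert (-((M + 1 : ℕ) : ℤ)) (insert ((M + 1 : ℕ) : ℤ) (Finset.Icc (-M : ℤ) M)) := by
        ext h; simp only [Finset.mem_Icc, Finset.mem_insert]; omega
      rw [hI, Finset.sum_insert (by simp; omega), Finset.sum_insert (by simp), ih,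
        Finset.sum_Icc_succ_top (by omega)]
      have h0 : ((M + 1 : ℕ) : ℤ) ≠ 0 := by omega
      simp only [truncCoeff, neg_eq_zero, h0, if_false, Int.cast_neg, Int.cast_natCast,
        Even.neg_pow (even_two_mul α), mul_neg, neg_mul, Real.cos_neg]
      ring
  rw [← heven]
  have : ∀ h : ℤ, (truncCoeff α β h : ℂ) * Complex.exp (2 * Real.pi * Complex.I * h * t)
      = ((truncCoeff α β h * Real.cos (2 * Real.pi * h * t) : ℝ) : ℂ)
        + ((truncCoeff α β h * Real.sin (2 * Real.pi * h * t) : ℝ) : ℂ) * Complex.I := by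
    intro h
    rw [show (2 * Real.pi * Complex.I * h * t : ℂ) = ((2 * Real.pi * h * t : ℝ) : ℂ) * Complex.I by
      push_cast; ring, Complex.exp_mul_I]
    push_cast
    ring
  simp only [this, Finset.sum_add_distrib, ← Finset.sum_mul]
  rw [← Complex.ofReal_sum, ← Complex.ofReal_sum, hodd]
  simp

/-- The multivariate character `x ↦ exp(2πi h·x)`. -/
noncomputable def expChar {s : ℕ} (h : Fin s → ℤ) (x : UnitCube s) : ℂ :=
  ∏ j, Complex.exp (2 * Real.pi * Complex.I * h j * (x j : ℝ))

theorem expChar_mul_conj {s : ℕ} (h : Fin s → ℤ) (x y : UnitCube s) :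
    expChar h x * (starRingEnd ℂ) (expChar h y)
      = ∏ j, Complex.exp (2 * Real.pi * Complex.I * h j * ((x j - y j : ℝ) : ℂ)) := by
  simp only [expChar, map_prod, ← Finset.prod_mul_distrib]
  refine Finset.prod_congr rfl fun j _ => ?_
  rw [← Complex.exp_conj, ← Complex.exp_add]
  congr 1
  simp only [map_mul, Complex.conj_ofReal, Complex.conj_I, map_intCast, map_ofNat]
  push_cast
  ring

theorem expChar_sub {s : ℕ} (a b : Fin s → ℤ) (x : UnitCube s) :
    expChar (a - b) x = expChar a x * (starRingEnd ℂ) (expChar b x) := by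
  simp only [expChar, map_prod, ← Finset.prod_mul_distrib]
  refine Finset.prod_congr rfl fun j _ => ?_
  rw [← Complex.exp_conj, ← Complex.exp_add]
  congr 1
  simp only [map_mul, Complex.conj_ofReal, Complex.conj_I, map_intCast, map_ofNat, Pi.sub_apply]
  push_cast
  ring

/-- The exponential sum `∑ w_n exp(2πi h·x_n)`. -/
noncomputable def expSum {s N : ℕ} (x : Fin N → UnitCube s) (w : Fin N → ℝ) (h : Fin s → ℤ) : ℂ :=
  ∑ n, w n * expChar h (x n)

theorem expSum_zero {s N : ℕ} (x : Fin N → UnitCube s) (w : Fin N → ℝ) :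
    expSum x w 0 = ((∑ n, w n : ℝ) : ℂ) := by
  simp [expSum, expChar]

theorem sum_truncKernel_eq {s : ℕ} (α : ℕ) (β : ℝ) (M : ℕ) {N : ℕ}
    (x : Fin N → UnitCube s) (w : Fin N → ℝ) :
    ∑ n, ∑ m, w n * w m * ∏ j, truncKernel α β M (x n j - x m j)
      = ∑ h ∈ Fintype.piFinset fun _ : Fin s => Finset.Icc (-M : ℤ) M,
        (∏ j, truncCoeff α β (h j)) * ‖expSum x w h‖ ^ 2 := by
  apply Complex.ofReal_injective
  push_cast
  simp only [truncKernel_eq_sum_exp, Finset.prod_univ_sum]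
  have h : ∀ h : Fin s → ℤ, ((‖expSum x w h‖ : ℂ)) ^ 2
      = ∑ n, ∑ m, (w n : ℂ) * w m * (expChar h (x n) * (starRingEnd ℂ) (expChar h (x m))) := by
    intro h
    rw [← Complex.mul_conj', expSum, map_sum, Finset.sum_mul_sum]
    refine Finset.sum_congr rfl fun n _ => Finset.sum_congr rfl fun m _ => ?_
    rw [map_mul, Complex.conj_ofReal]
    ring
  simp only [h, Finset.prod_mul_distrib, ← expChar_mul_conj, Finset.mul_sum]
  conv_rhs => rw [Finset.sum_comm]
  refine Finset.sum_congr rfl fun n _ => ?_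
  conv_rhs => rw [Finset.sum_comm]
  refine Finset.sum_congr rfl fun m _ => Finset.sum_congr rfl fun h _ => ?_
  ring

theorem Matrix.IsHermitian.trace_mul_self_eq_sum {ι : Type*} [Fintype ι] [DecidableEq ι]
    {A : Matrix ι ι ℂ} (hA : A.IsHermitian) :
    (A * A).trace = ((∑ i, hA.eigenvalues i ^ 2 : ℝ) : ℂ) := by
  have h : A * A = Unitary.conjStarAlgAut ℂ _ hA.eigenvectorUnitary
      (diagonal (RCLike.ofReal ∘ hA.eigenvalues) * diagonal (RCLike.ofReal ∘ hA.eigenvalues)) := by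
    rw [map_mul, ← hA.spectral_theorem]
  rw [h, Unitary.conjStarAlgAut_apply, Matrix.trace_mul_cycle]
  simp [Matrix.trace, sq]

theorem Matrix.IsHermitian.trace_sq_le_rank_mul {ι : Type*} [Fintype ι]
    {A : Matrix ι ι ℂ} (hA : A.IsHermitian) :
    ‖A.trace‖ ^ 2 ≤ A.rank * ∑ a, ∑ b, ‖A a b‖ ^ 2 := by
  classical
  have h1 : ∑ i, hA.eigenvalues i ^ 2 = ∑ a, ∑ b, ‖A a b‖ ^ 2 := by
    apply Complex.ofReal_injective
    rw [← hA.trace_mul_self_eq_sum]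
    simp only [Matrix.trace, Matrix.diag, Matrix.mul_apply]
    push_cast
    refine Finset.sum_congr rfl fun a _ => Finset.sum_congr rfl fun b _ => ?_
    rw [← Complex.mul_conj', ← hA.apply a b]
    simp
  rw [← h1, hA.trace_eq_sum_eigenvalues, hA.rank_eq_card_non_zero_eigs, Fintype.card_subtype]
  have h2 : (∑ i, (hA.eigenvalues i : ℂ))
      = ((∑ i with hA.eigenvalues i ≠ 0, hA.eigenvalues i : ℝ) : ℂ) := by
    rw [Finset.sum_filter_ne_zero]; simp
  have h3 : ‖∑ i, (hA.eigenvalues i : ℂ)‖ ^ 2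
      = (∑ i with hA.eigenvalues i ≠ 0, hA.eigenvalues i) ^ 2 := by
    rw [h2, Complex.norm_real, Real.norm_eq_abs, sq_abs]
  refine h3.le.trans (sq_sum_le_card_mul_sum_sq.trans ?_)
  gcongr
  exact Finset.subset_univ _

theorem norm_sum_mul_sq_le {ι κ : Type*} [Fintype ι] [Fintype κ] (φ : ι → κ → ℂ) (w : κ → ℝ) :
    ‖∑ a, ∑ n, (w n : ℂ) * (φ a n * (starRingEnd ℂ) (φ a n))‖ ^ 2
      ≤ Fintype.card κ * ∑ a, ∑ b, ‖∑ n, (w n : ℂ) * (φ a n * (starRingEnd ℂ) (φ b n))‖ ^ 2 := by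
  classical
  set A : Matrix ι ι ℂ := Matrix.of fun a b => ∑ n, (w n : ℂ) * (φ a n * (starRingEnd ℂ) (φ b n))
    with hAdef
  have hA : A.IsHermitian := by
    ext a b
    simp [hAdef, mul_comm]
  have hr : A.rank ≤ Fintype.card κ := by
    have : A = (Matrix.of φ) * (Matrix.of fun n b => (w n : ℂ) * (starRingEnd ℂ) (φ b n)) := by
      ext a b
      simp [hAdef, Matrix.mul_apply, mul_left_comm]
    rw [this]
    exact (Matrix.rank_mul_le_left _ _).trans (Matrix.rank_le_card_width _)
  refine (hA.trace_sq_le_rank_mul).trans ?_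
  gcongr
  simp [hAdef]

/-- The integer frequencies `h` with `|h_j| < 2^(k_j)` for all `j`. -/
noncomputable def dyadicBox {s : ℕ} (k : Fin s → ℕ) : Finset (Fin s → ℤ) :=
  Fintype.piFinset fun j => Finset.Ioo (-2 ^ k j : ℤ) (2 ^ k j)

theorem sum_sub_le_sum_dyadicBox {s : ℕ} (k : Fin s → ℕ) (g : (Fin s → ℤ) → ℝ) (hg : ∀ h, 0 ≤ g h) :
    ∑ a : (j : Fin s) → Fin (2 ^ k j), ∑ b : (j : Fin s) → Fin (2 ^ k j),
        g ((fun j => ((a j : ℕ) : ℤ)) - fun j => ((b j : ℕ) : ℤ))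
      ≤ 2 ^ (∑ j, k j) * ∑ h ∈ dyadicBox k, g h := by
  have hcard : (Fintype.card ((j : Fin s) → Fin (2 ^ k j)) : ℝ) = 2 ^ (∑ j, k j) := by
    simp [Fintype.card_pi, Finset.prod_pow_eq_pow_sum]
  rw [← hcard, ← nsmul_eq_mul, ← Finset.card_univ]
  refine Finset.sum_le_card_nsmul _ _ _ fun a _ => ?_
  set φ : ((j : Fin s) → Fin (2 ^ k j)) → Fin s → ℤ :=
    fun b => (fun j => ((a j : ℕ) : ℤ)) - fun j => ((b j : ℕ) : ℤ) with hφ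
  have hinj : Function.Injective φ := by
    intro b b' hb
    funext j
    have := congrFun hb j
    simp only [hφ, Pi.sub_apply] at this
    exact Fin.ext (by omega)
  rw [← Finset.sum_image (f := g) (g := φ) (s := Finset.univ) hinj.injOn]
  refine Finset.sum_le_sum_of_subset_of_nonneg ?_ fun h _ _ => hg h
  intro h hh
  obtain ⟨b, -, rfl⟩ := Finset.mem_image.1 hh
  refine Fintype.mem_piFinset.2 fun j => ?_
  have h1 := (a j).2
  have h2 := (b j).2
  zify at h1 h2
  simp only [hφ, Pi.sub_apply, Finset.mem_Ioo]
  omega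

theorem two_pow_mul_sq_le_sum_dyadicBox {s N : ℕ} (k : Fin s → ℕ) (x : Fin N → UnitCube s)
    (w : Fin N → ℝ) :
    2 ^ (∑ j, k j) * (∑ n, w n) ^ 2 ≤ N * ∑ h ∈ dyadicBox k, ‖expSum x w h‖ ^ 2 := by
  have hcard : (Fintype.card ((j : Fin s) → Fin (2 ^ k j)) : ℝ) = 2 ^ (∑ j, k j) := by
    simp [Fintype.card_pi, Finset.prod_pow_eq_pow_sum]
  have h1 := norm_sum_mul_sq_le
    (fun (a : (j : Fin s) → Fin (2 ^ k j)) n => expChar (fun j => ((a j : ℕ) : ℤ)) (x n)) w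
  simp only [← expChar_sub] at h1
  have h2 := sum_sub_le_sum_dyadicBox k (fun h => ‖expSum x w h‖ ^ 2) fun h => by positivity
  have h3 : ∀ h, ∑ n, (w n : ℂ) * expChar h (x n) = expSum x w h := fun h => rfl
  simp only [h3, sub_self, expSum_zero, Fintype.card_fin, Finset.sum_const, nsmul_eq_mul,
    Finset.card_univ, norm_mul, Complex.norm_natCast, hcard, Complex.norm_real,
    mul_pow, Real.norm_eq_abs, sq_abs] at h1
  have h4 := h1.trans (mul_le_mul_of_nonneg_left h2 N.cast_nonneg)
  have hp : (0 : ℝ) < 2 ^ (∑ j, k j) := by positivity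
  refine le_of_mul_le_mul_left ?_ hp
  linarith

theorem sq_le_sum_dyadicBox_erase {s N : ℕ} (hN : 1 ≤ N) (k : Fin s → ℕ)
    (hk : 2 * N ≤ 2 ^ (∑ j, k j)) (x : Fin N → UnitCube s) (w : Fin N → ℝ) :
    (∑ n, w n) ^ 2 ≤ ∑ h ∈ (dyadicBox k).erase 0, ‖expSum x w h‖ ^ 2 := by
  have h0 : (0 : Fin s → ℤ) ∈ dyadicBox k := Fintype.mem_piFinset.2 fun j => by simp
  have h1 := two_pow_mul_sq_le_sum_dyadicBox k x w
  rw [← Finset.add_sum_erase _ _ h0, expSum_zero, Complex.norm_real, Real.norm_eq_abs,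
    sq_abs] at h1
  have hN' : (0 : ℝ) < N := by exact_mod_cast hN
  have hk' : (2 * N : ℝ) ≤ 2 ^ (∑ j, k j) := by exact_mod_cast hk
  have h2 := (mul_le_mul_of_nonneg_right hk' (sq_nonneg (∑ n, w n))).trans h1
  refine le_of_mul_le_mul_left ?_ hN'
  linarith

theorem sum_dyadic_le_truncCoeff {α : ℕ} (hα : α ≠ 0) {β : ℝ} (hβ : 0 < β) (hβ1 : β ≤ 1) (h : ℤ)
    (m : ℕ) : ∑ i ∈ Finset.range (m + 1),
        (if h ∈ Finset.Ioo (-2 ^ i : ℤ) (2 ^ i) then ((1 / 4 : ℝ) ^ α) ^ i else 0)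
      ≤ 2 / β * truncCoeff α β h := by
  set q : ℝ := (1 / 4) ^ α with hq
  have hq0 : 0 ≤ q := by positivity
  have hq1 : q ≤ 1 / 2 := by
    calc q ≤ (1 / 4) ^ 1 := pow_le_pow_of_le_one (by norm_num) (by norm_num) (by omega)
      _ ≤ 1 / 2 := by norm_num
  set l := h.natAbs.size with hl
  have hsum : ∑ i ∈ Finset.range (m + 1),
      (if h ∈ Finset.Ioo (-2 ^ i : ℤ) (2 ^ i) then q ^ i else 0)
      ≤ ∑ i ∈ Finset.Ico l (max l (m + 1)), q ^ i := by
    rw [← Finset.sum_filter]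
    refine Finset.sum_le_sum_of_subset_of_nonneg (fun i hi => ?_) fun _ _ _ => by positivity
    simp only [Finset.mem_filter, Finset.mem_range, Finset.mem_Ioo] at hi
    have : h.natAbs < 2 ^ i := by zify; rw [abs_lt]; exact hi.2
    have := Nat.size_le.2 this
    simp only [Finset.mem_Ico]
    omega
  have hgeom : ∑ i ∈ Finset.Ico l (max l (m + 1)), q ^ i ≤ 2 * q ^ l := by
    refine (geom_sum_Ico_le_of_lt_one hq0 (by linarith)).trans ?_
    rw [div_le_iff₀ (by linarith)]
    have : 0 ≤ q ^ l := by positivity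
    nlinarith
  refine (hsum.trans hgeom).trans ?_
  unfold truncCoeff
  split_ifs with h0
  · have : q ^ l ≤ 1 := pow_le_one₀ hq0 (by linarith)
    have : 1 ≤ 1 / β := (one_le_div hβ).2 hβ1
    rw [mul_one, div_eq_mul_one_div 2 β]
    linarith
  · have h1 : (h.natAbs : ℝ) ≤ 2 ^ l := by exact_mod_cast (Nat.lt_size_self _).le
    have h2 : (0 : ℝ) < h.natAbs := by exact_mod_cast Int.natAbs_pos.2 h0
    have h3 : (h : ℝ) ^ (2 * α) = (h.natAbs : ℝ) ^ (2 * α) := by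
      rw [Nat.cast_natAbs, Int.cast_abs, Even.pow_abs (even_two_mul α)]
    have h4 : q ^ l = 1 / ((2 : ℝ) ^ l) ^ (2 * α) := by
      rw [hq, ← pow_mul, one_div_pow, show (4 : ℝ) = 2 ^ 2 by norm_num, ← pow_mul, ← pow_mul]
      congr 2
      ring
    rw [h3, h4, div_mul_div_comm, mul_comm 2 β, mul_div_mul_left _ _ hβ.ne', mul_one_div]
    gcongr

/-- The exponent vectors of total degree `m`. -/
noncomputable def degreeVectors (s m : ℕ) : Finset (Fin s → ℕ) :=
  ((Finset.univ : Finset (Fin s)).finsuppAntidiag m).map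
    ⟨fun f : Fin s →₀ ℕ => ⇑f, DFunLike.coe_injective⟩

theorem sum_eq_of_mem_degreeVectors {s m : ℕ} {k : Fin s → ℕ} (hk : k ∈ degreeVectors s m) :
    ∑ j, k j = m := by
  obtain ⟨f, hf, rfl⟩ := Finset.mem_map.1 hk
  exact (Finset.mem_finsuppAntidiag.1 hf).1

theorem card_degreeVectors (s m : ℕ) : (degreeVectors s m).card = (s + m - 1).choose m := by
  rw [degreeVectors, Finset.card_map, Finset.card_finsuppAntidiag_nat_eq_choose, Finset.card_univ,
    Fintype.card_fin]

theorem card_filter_dyadicBox_le {s α : ℕ} (hα : α ≠ 0) {β : ℝ} (hβ : 0 < β) (hβ1 : β ≤ 1)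
    (h : Fin s → ℤ) (m : ℕ) :
    (((degreeVectors s m).filter fun k => h ∈ dyadicBox k).card : ℝ)
      ≤ (4 ^ α) ^ m * (2 / β) ^ s * ∏ j, truncCoeff α β (h j) := by
  have h1 : ∏ j, ∑ i ∈ Finset.range (m + 1),
      (if h j ∈ Finset.Ioo (-2 ^ i : ℤ) (2 ^ i) then ((1 / 4 : ℝ) ^ α) ^ i else 0)
      ≤ (2 / β) ^ s * ∏ j, truncCoeff α β (h j) := by
    refine (Finset.prod_le_prod (fun j _ => Finset.sum_nonneg fun i _ => ?_)
      fun j _ => sum_dyadic_le_truncCoeff hα hβ hβ1 (h j) m).trans_eq ?_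
    · split_ifs <;> positivity
    · rw [Finset.prod_mul_distrib, Finset.prod_const, Finset.card_univ, Fintype.card_fin]
  rw [mul_assoc]
  refine le_trans ?_ (mul_le_mul_of_nonneg_left h1 (by positivity))
  rw [Finset.prod_univ_sum, Finset.mul_sum, Finset.card_eq_sum_ones, Nat.cast_sum]
  refine (Finset.sum_le_sum (g := fun k : Fin s → ℕ => (4 ^ α) ^ m * ∏ j,
    (if h j ∈ Finset.Ioo (-2 ^ k j : ℤ) (2 ^ k j) then ((1 / 4 : ℝ) ^ α) ^ k j else 0))
    fun k hk => ?_).trans (Finset.sum_le_sum_of_subset_of_nonneg ?_ fun k _ _ => ?_)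
  · obtain ⟨hk, hkh⟩ := Finset.mem_filter.1 hk
    have hkh' := Fintype.mem_piFinset.1 hkh
    rw [Finset.prod_congr rfl fun j _ => if_pos (hkh' j), Finset.prod_pow_eq_pow_sum,
      sum_eq_of_mem_degreeVectors hk, ← mul_pow, ← mul_pow]
    norm_num
  · intro k hk
    have hk := sum_eq_of_mem_degreeVectors (Finset.mem_filter.1 hk).1
    refine Fintype.mem_piFinset.2 fun j => Finset.mem_range_succ_iff.2 ?_
    rw [← hk]
    exact Finset.single_le_sum (f := k) (fun _ _ => Nat.zero_le _) (Finset.mem_univ j)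
  · refine mul_nonneg (by positivity) (Finset.prod_nonneg fun j _ => ?_)
    split_ifs <;> positivity

theorem dyadicBox_subset {s m : ℕ} {k : Fin s → ℕ} (hk : k ∈ degreeVectors s m) :
    dyadicBox k ⊆ Fintype.piFinset fun _ : Fin s => Finset.Icc (-(2 ^ m : ℕ) : ℤ) (2 ^ m : ℕ) := by
  refine Fintype.piFinset_subset _ _ fun j => ?_
  have h1 : k j ≤ m := by
    rw [← sum_eq_of_mem_degreeVectors hk]
    exact Finset.single_le_sum (f := k) (fun _ _ => Nat.zero_le _) (Finset.mem_univ j)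
  have h2 : (2 : ℤ) ^ k j ≤ 2 ^ m := pow_le_pow_right₀ (by norm_num) h1
  intro i hi
  simp only [Finset.mem_Ioo, Finset.mem_Icc] at hi ⊢
  push_cast
  omega

theorem sum_truncKernel_ge {s α : ℕ} (hα : α ≠ 0) {β : ℝ} (hβ : 0 < β) (hβ1 : β ≤ 1) {N m : ℕ}
    (hN : 1 ≤ N) (hm : 2 * N ≤ 2 ^ m) (x : Fin N → UnitCube s) (w : Fin N → ℝ) :
    (1 + (s + m - 1).choose m * ((β / 2) ^ s * ((1 / 4) ^ α) ^ m)) * (∑ n, w n) ^ 2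
      ≤ ∑ n, ∑ i, w n * w i * ∏ j, truncKernel α β (2 ^ m) (x n j - x i j) := by
  classical
  rw [sum_truncKernel_eq]
  set B := Fintype.piFinset fun _ : Fin s => Finset.Icc (-(2 ^ m : ℕ) : ℤ) (2 ^ m : ℕ) with hB
  have h0 : (0 : Fin s → ℤ) ∈ B := Fintype.mem_piFinset.2 fun j => by simp
  rw [← Finset.add_sum_erase _ _ h0, expSum_zero, Complex.norm_real, Real.norm_eq_abs, sq_abs]
  have h1 : ((s + m - 1).choose m : ℝ) * (∑ n, w n) ^ 2
      ≤ ∑ k ∈ degreeVectors s m, ∑ h ∈ (dyadicBox k).erase 0, ‖expSum x w h‖ ^ 2 := by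
    rw [← card_degreeVectors, ← nsmul_eq_mul]
    refine Finset.card_nsmul_le_sum _ _ _ fun k hk => ?_
    exact sq_le_sum_dyadicBox_erase hN k (by rwa [sum_eq_of_mem_degreeVectors hk]) x w
  have h2 : ∑ k ∈ degreeVectors s m, ∑ h ∈ (dyadicBox k).erase 0, ‖expSum x w h‖ ^ 2
      = ∑ h ∈ B.erase 0, ((degreeVectors s m).filter fun k => h ∈ dyadicBox k).card
        * ‖expSum x w h‖ ^ 2 := by
    rw [Finset.sum_comm' (t' := B.erase 0)
      (s' := fun h => (degreeVectors s m).filter fun k => h ∈ dyadicBox k)]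
    · simp
    · intro k h
      simp only [Finset.mem_erase, Finset.mem_filter]
      exact ⟨fun ⟨hk, hh, hb⟩ => ⟨⟨hk, hb⟩, hh, dyadicBox_subset hk hb⟩,
        fun ⟨⟨hk, hb⟩, hh, _⟩ => ⟨hk, hh, hb⟩⟩
  have h3 : ((s + m - 1).choose m : ℝ) * (∑ n, w n) ^ 2 ≤ (4 ^ α) ^ m * (2 / β) ^ s *
      ∑ h ∈ B.erase 0, (∏ j, truncCoeff α β (h j)) * ‖expSum x w h‖ ^ 2 := by
    refine (h1.trans_eq h2).trans ?_
    rw [Finset.mul_sum]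
    refine Finset.sum_le_sum fun h _ => ?_
    rw [← mul_assoc]
    exact mul_le_mul_of_nonneg_right (card_filter_dyadicBox_le hα hβ hβ1 h m) (by positivity)
  have h4 : ((β / 2) ^ s * ((1 / 4 : ℝ) ^ α) ^ m) * ((4 ^ α) ^ m * (2 / β) ^ s) = 1 := by
    rw [show ((β / 2) ^ s * ((1 / 4 : ℝ) ^ α) ^ m) * ((4 ^ α) ^ m * (2 / β) ^ s)
      = (β / 2 * (2 / β)) ^ s * ((1 / 4 * 4) ^ α) ^ m by simp only [mul_pow]; ring]
    have : β / 2 * (2 / β) = 1 := by field_simp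
    rw [this]
    norm_num
  have h5 := mul_le_mul_of_nonneg_left h3
    (by positivity : 0 ≤ (β / 2) ^ s * ((1 / 4 : ℝ) ^ α) ^ m)
  rw [← mul_assoc _ _ (∑ h ∈ B.erase 0, _), h4, one_mul] at h5
  have h6 : ∏ j : Fin s, truncCoeff α β ((0 : Fin s → ℤ) j) = 1 := by simp [truncCoeff]
  rw [h6]
  linarith

theorem le_one_add_mul_sq_sub {t : ℝ} (ht0 : 0 ≤ t) (ht1 : t ≤ 1) (W : ℝ) :
    t / 2 ≤ (1 + t) * W ^ 2 - 2 * W + 1 := by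
  nlinarith [sq_nonneg ((1 + t) * W - 1), mul_nonneg ht0 (sub_nonneg.2 ht1)]

theorem choose_mul_le_one (s m : ℕ) {α : ℕ} (hα : α ≠ 0) {β : ℝ} (hβ : 0 ≤ β) (hβ1 : β ≤ 1) :
    ((s + m - 1).choose m : ℝ) * ((β / 2) ^ s * ((1 / 4) ^ α) ^ m) ≤ 1 := by
  have h1 : ((s + m - 1).choose m : ℝ) ≤ 2 ^ (s + m) := by
    have h := (Nat.choose_le_two_pow (s + m - 1) m).trans
      (Nat.pow_le_pow_right (n := 2) (by norm_num) (Nat.sub_le (s + m) 1))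
    exact_mod_cast h
  have h2 : ((1 / 4 : ℝ)) ^ α ≤ 1 / 2 :=
    (pow_le_pow_of_le_one (by norm_num) (by norm_num) (by omega : 1 ≤ α)).trans (by norm_num)
  calc ((s + m - 1).choose m : ℝ) * ((β / 2) ^ s * ((1 / 4) ^ α) ^ m)
      ≤ 2 ^ (s + m) * ((1 / 2) ^ s * (1 / 2) ^ m) := by gcongr
    _ = 1 := by rw [← pow_add, ← mul_pow]; norm_num

theorem pow_le_factorial_mul_choose {s : ℕ} (hs : 1 ≤ s) (m : ℕ) :
    ((m : ℝ) + 1) ^ (s - 1) ≤ (s - 1).factorial * (s + m - 1).choose m := by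
  have h := Nat.pow_le_choose (α := ℝ) (s - 1) (s + m - 1)
  rw [div_le_iff₀ (by positivity), show s + m - 1 + 1 - (s - 1) = m + 1 by omega,
    ← Nat.choose_symm (by omega), show s + m - 1 - (s - 1) = m by omega] at h
  push_cast at h
  linarith

theorem exists_pos_le_one_mul_le {s : ℕ} (γ : Fin s → ℝ≥0) (hγ : ∀ j, 0 < γ j) (α : ℕ) :
    ∃ β : ℝ, 0 < β ∧ β ≤ 1 ∧ ∀ j, β * (2 * Real.pi) ^ (2 * α) ≤ γ j := by
  have hp : 0 < (2 * Real.pi) ^ (2 * α) := by positivity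
  obtain ⟨δ, hδ, hδγ⟩ : ∃ δ : ℝ, 0 < δ ∧ ∀ j, δ ≤ γ j := by
    rcases isEmpty_or_nonempty (Fin s) with h | h
    · exact ⟨1, one_pos, fun j => h.elim j⟩
    · obtain ⟨i, hi⟩ := Finite.exists_min γ
      exact ⟨γ i, hγ i, fun j => hi j⟩
  refine ⟨min 1 (δ / (2 * Real.pi) ^ (2 * α)), by positivity, min_le_left _ _, fun j => ?_⟩
  exact ((le_div_iff₀ hp).1 (min_le_right _ _)).trans (hδγ j)

theorem mainTheorem3 (s α : ℕ) (hs : 1 ≤ s) [NeZero α] (hα : 2 ≤ α)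
    (γ : Fin s → ℝ≥0) (hγ : ∀ j, 0 < γ j) :
    ∃ c : ℝ, 0 < c ∧ ∀ (N : ℕ) (_ : 1 ≤ N) (x : Fin N → UnitCube s) (w : Fin N → ℝ),
      ENNReal.ofReal (c * Real.log N ^ (((s : ℝ) - 1) / 2) / (N : ℝ) ^ α)
        ≤ worstCaseError (WeightedSobolevSpace α fun u => ∏ j ∈ u, γ j) x w := by
  obtain ⟨β, hβ, hβ1, hβγ⟩ := exists_pos_le_one_mul_le γ hγ α
  have hα0 : α ≠ 0 := NeZero.ne α
  set C : ℝ := (β / 2) ^ s / (2 * (s - 1).factorial * 4 ^ (2 * α)) with hC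
  have hCpos : 0 < C := by positivity
  refine ⟨√C, Real.sqrt_pos.2 hCpos, fun N hN x w => ?_⟩
  refine le_trans (ENNReal.ofReal_le_ofReal ?_) (sqrt_le_worstCaseError γ x w)
  set m := Nat.clog 2 (2 * N) with hm
  have hm1 : 2 * N ≤ 2 ^ m := Nat.le_pow_clog (by norm_num) _
  have hm2 : 2 ^ m ≤ 4 * N := by
    have h1 := Nat.pow_pred_clog_lt_self (b := 2) (by norm_num) (by omega : 1 < 2 * N)
    have h2 : 0 < m := Nat.clog_pos (by norm_num) (by omega)
    rw [← hm] at h1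
    obtain ⟨i, hi⟩ := Nat.exists_eq_succ_of_ne_zero h2.ne'
    rw [hi] at h1 ⊢
    rw [Nat.pred_succ] at h1
    rw [pow_succ]
    omega
  have hN0 : (1 : ℝ) ≤ N := by exact_mod_cast hN
  have hlog0 : 0 ≤ Real.log N := Real.log_nonneg hN0
  have hlog : Real.log N ≤ m + 1 := by
    have h1 : (N : ℝ) ≤ 2 ^ m := by exact_mod_cast (by omega : N ≤ 2 ^ m)
    have h2 := Real.log_le_log (by linarith) h1
    rw [Real.log_pow] at h2
    have h3 : (m : ℝ) * Real.log 2 ≤ m * 1 := by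
      gcongr
      exact Real.log_two_lt_d9.le.trans (by norm_num)
    linarith
  set t : ℝ := (s + m - 1).choose m * ((β / 2) ^ s * ((1 / 4) ^ α) ^ m) with ht
  have hE := le_one_add_mul_sq_sub (by positivity : 0 ≤ t)
    (choose_mul_le_one s m hα0 hβ.le hβ1) (∑ n, w n)
  have hQ := (sum_truncKernel_ge hα0 hβ hβ1 hN hm1 x w).trans
    (sum_truncKernel_le_sum_weightedKernel hα0 γ hβ.le hβγ (2 ^ m) x w)
  refine Real.le_sqrt_of_sq_le (le_trans ?_ (hE.trans (by linarith)))
  have hsq : (Real.log N ^ (((s : ℝ) - 1) / 2)) ^ 2 = Real.log N ^ (s - 1) := by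
    rw [← Real.rpow_natCast, ← Real.rpow_mul hlog0, ← Real.rpow_natCast, Nat.cast_sub hs]
    congr 1
    push_cast
    ring
  rw [div_pow, mul_pow, Real.sq_sqrt hCpos.le, hsq]
  have h1 : Real.log N ^ (s - 1) ≤ (s - 1).factorial * (s + m - 1).choose m :=
    (pow_le_pow_left₀ hlog0 hlog _).trans (pow_le_factorial_mul_choose hs m)
  have h2 : ((1 / 4 : ℝ) ^ α) ^ m = 1 / ((2 : ℝ) ^ m) ^ (2 * α) := by
    rw [← pow_mul, one_div_pow, show (4 : ℝ) = 2 ^ 2 by norm_num, ← pow_mul, ← pow_mul]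
    congr 2
    ring
  have h3 : 1 / (4 * (N : ℝ)) ^ (2 * α) ≤ ((1 / 4 : ℝ) ^ α) ^ m := by
    rw [h2]
    have : (2 : ℝ) ^ m ≤ 4 * N := by exact_mod_cast hm2
    gcongr
  calc C * Real.log N ^ (s - 1) / ((N : ℝ) ^ α) ^ 2
      ≤ C * ((s - 1).factorial * (s + m - 1).choose m) / ((N : ℝ) ^ α) ^ 2 := by gcongr
    _ = (s + m - 1).choose m * ((β / 2) ^ s * (1 / (4 * (N : ℝ)) ^ (2 * α))) / 2 := by
      rw [hC, mul_pow, ← pow_mul, mul_comm α 2]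
      field_simp
    _ ≤ t / 2 := by rw [ht]; gcongr
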